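/- Let $K$ be a field and $n\ge 1$. Let $F_{5n+1}$ be the friendship graph with $2n+1$ vertices and $3n$ edges, i.e. $n$ triangles with exactly one vertex in common. For a finite simple graph $G$, the total simplicial complex $\Delta_T(G)$ is the simplicial complex on the vertex set $V(G)\cup E(G)$ (disjoint union) generated by the following sets, called total indices: (i) $\{p,q,r\}$ with $p,q,r$ distinct vertices of $G$ that can be listed so that $p,q$ are adjacent and $q,r$ are adjacent; (ii) $\{e,f,g\}$ with $e,f,g$ distinct edges of $G$ that can be listed so that $e,f$ share an endpoint and $f,g$ share an endpoint; (iii) $\{p,q,e\}$ with $p,q$ adjacent vertices and $e$ an edge incident to $p$ or to $q$; (iv) $\{e,f,v\}$ with $e\neq f$ edges sharing an endpoint and $v$ a vertex incident to $e$ or to $f$; (v) $\{p\}$ with $p$ an isolated vertex of $G$. Let $H_r(\Delta_T(F_{5n+1}))$ denote the (unreduced) simplicial homology of $\Delta_T(F_{5n+1})$ with coefficients in $K$, computed from the chain complex of faces oriented by any total ordering of the vertex set $V\cup E$. Then $$H_r(\Delta_T(F_{5n+1}))\cong\begin{cases}K, & r=0,\\ 0, & r=1,\\ K^{\beta_2},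 & r=2,\\ 0, & r\ge 3,\end{cases}\qquad\text{where } \beta_2=\frac{4n^3+12n^2+14n}{3}$$ (which is an integer). -/

import Mathlib

/-! ### Simplicial homology of an abstract simplicial complex with linearly ordered vertices -/

section SimplicialHomology

/-- The `r`-dimensional faces of `Δ`: the faces with exactly `r + 1` vertices. -/
abbrev FacesOfDim {V : Type*} (Δ : PreAbstractSimplicialComplex V) (r : ℕ) : Type _ :=
  {s : Finset V // s ∈ Δ.faces ∧ s.card = r + 1}

/-- The module `C_r(Δ)` of `r`-chains: the free `K`-module on the `r`-dimensional faces. -/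
def SimplicialChain (K : Type*) [CommRing K] {V : Type*}
    (Δ : PreAbstractSimplicialComplex V) (r : ℕ) : Type _ :=
  FacesOfDim Δ r →₀ K

noncomputable instance SimplicialChain.instAddCommGroup (K : Type*) [CommRing K] {V : Type*}
    (Δ : PreAbstractSimplicialComplex V) (r : ℕ) : AddCommGroup (SimplicialChain K Δ r) :=
  inferInstanceAs (AddCommGroup (FacesOfDim Δ r →₀ K))

noncomputable instance SimplicialChain.instModule (K : Type*) [CommRing K] {V : Type*}
    (Δ : PreAbstractSimplicialComplex V) (r : ℕ) : Module K (SimplicialChain K Δ r) :=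
  inferInstanceAs (Module K (FacesOfDim Δ r →₀ K))

/-- The `r`-dimensional faces form a basis of `C_r(Δ)`. -/
noncomputable def SimplicialChain.basis (K : Type*) [CommRing K] {V : Type*}
    (Δ : PreAbstractSimplicialComplex V) (r : ℕ) :
    Module.Basis (FacesOfDim Δ r) K (SimplicialChain K Δ r) :=
  Module.Basis.ofRepr (LinearEquiv.refl K (FacesOfDim Δ r →₀ K))

/-- The codimension one face of an `(r + 1)`-dimensional face obtained by removing a vertex. -/
def FacesOfDim.erase {V : Type*} [LinearOrder V] {Δ : PreAbstractSimplicialComplex V} {r : ℕ}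
    (σ : FacesOfDim Δ (r + 1)) (v : V) (hv : v ∈ σ.1) : FacesOfDim Δ r :=
  ⟨σ.1.erase v, by
    have hc : (σ.1.erase v).card = r + 1 := by
      rw [Finset.card_erase_of_mem hv, σ.2.2]; rfl
    exact ⟨(Δ.isRelLowerSet_faces σ.2.1).2 (Finset.erase_subset v σ.1)
      (Finset.card_pos.mp (by omega)), hc⟩⟩

/-- The position `j` of the vertex `v = v_j` in `σ = {v_0 < v_1 < ⋯}`. -/
def vertexPosition {V : Type*} [LinearOrder V] (σ : Finset V) (v : V) : ℕ :=
  (σ.filter (· < v)).card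

/-- The boundary operator `∂_{r+1} : C_{r+1}(Δ) → C_r(Δ)`,
`∂ {v_0 < ⋯ < v_{r+1}} = ∑ j, (-1)^j {v_0, …, v_{j-1}, v_{j+1}, …, v_{r+1}}`. -/
noncomputable def simplicialBoundary (K : Type*) [CommRing K] {V : Type*} [LinearOrder V]
    (Δ : PreAbstractSimplicialComplex V) (r : ℕ) :
    SimplicialChain K Δ (r + 1) →ₗ[K] SimplicialChain K Δ r :=
  (SimplicialChain.basis K Δ (r + 1)).constr K fun σ : FacesOfDim Δ (r + 1) =>
    ∑ v ∈ σ.1.attach,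
      (-1 : K) ^ vertexPosition σ.1 v.1 • SimplicialChain.basis K Δ r (σ.erase v.1 v.2)

/-- The `r`-cycles `Z_r(Δ) = Ker ∂_r`, where `∂_0 = 0`. -/
noncomputable def simplicialCycles (K : Type*) [CommRing K] {V : Type*} [LinearOrder V]
    (Δ : PreAbstractSimplicialComplex V) : (r : ℕ) → Submodule K (SimplicialChain K Δ r)
  | 0 => ⊤
  | r + 1 => LinearMap.ker (simplicialBoundary K Δ r)

/-- The `r`-boundaries `B_r(Δ) = Im ∂_{r+1}`. -/
noncomputable def simplicialBoundaries (K : Type*) [CommRing K] {V : Type*} [LinearOrder V]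
    (Δ : PreAbstractSimplicialComplex V) (r : ℕ) : Submodule K (SimplicialChain K Δ r) :=
  LinearMap.range (simplicialBoundary K Δ r)

/-- Removing an earlier vertex lowers the position by one, removing a later one does not. -/
theorem vertexPosition_erase_sign (K : Type*) [CommRing K] {V : Type*} [LinearOrder V]
    (σ : Finset V) {v w : V} (hv : v ∈ σ) (hvw : v < w) :
    (-1 : K) ^ vertexPosition σ v * (-1) ^ vertexPosition (σ.erase v) w +
      (-1) ^ vertexPosition σ w * (-1) ^ vertexPosition (σ.erase w) v = 0 := by
  have h1 : vertexPosition σ w = vertexPosition (σ.erase v) w + 1 := by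
    unfold vertexPosition
    rw [Finset.filter_erase, Finset.card_erase_add_one (by simp [hv, hvw])]
  have h2 : vertexPosition (σ.erase w) v = vertexPosition σ v := by
    unfold vertexPosition
    rw [Finset.filter_erase, Finset.erase_eq_of_notMem (by simp [hvw.le])]
  rw [h1, h2]
  ring

/-- The boundary operators satisfy `∂ ∘ ∂ = 0`. -/
theorem simplicialBoundary_comp (K : Type*) [CommRing K] {V : Type*} [LinearOrder V]
    (Δ : PreAbstractSimplicialComplex V) (r : ℕ) :
    simplicialBoundary K Δ r ∘ₗ simplicialBoundary K Δ (r + 1) = 0 := by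
  refine (SimplicialChain.basis K Δ (r + 1 + 1)).ext fun σ => ?_
  simp only [LinearMap.comp_apply, LinearMap.zero_apply, simplicialBoundary,
    Module.Basis.constr_basis, map_sum, map_smul, Finset.smul_sum, smul_smul]
  rw [Finset.sum_sigma']
  refine Finset.sum_involution
    (fun x _ => ⟨⟨x.2.1, Finset.mem_of_mem_erase x.2.2⟩, ⟨x.1.1, Finset.mem_erase.mpr
      ⟨(Finset.ne_of_mem_erase x.2.2).symm, x.1.2⟩⟩⟩) ?_ ?_ ?_ ?_
  · rintro ⟨⟨v, hv⟩, ⟨w, hw⟩⟩ -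
    have hw' : w ∈ σ.1 := Finset.mem_of_mem_erase hw
    have hne : w ≠ v := Finset.ne_of_mem_erase hw
    have hface : (σ.erase w hw').erase v (Finset.mem_erase.mpr ⟨hne.symm, hv⟩) =
        (σ.erase v hv).erase w hw := Subtype.ext (Finset.erase_right_comm)
    simp only [hface]
    rw [← add_smul]
    rcases lt_or_gt_of_ne hne with h | h
    · rw [add_comm]
      exact (congrArg (· • _) (vertexPosition_erase_sign K σ.1 hw' h)).trans (zero_smul _ _)
    · exact (congrArg (· • _) (vertexPosition_erase_sign K σ.1 hv h)).trans (zero_smul _ _)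
  · rintro ⟨⟨v, hv⟩, ⟨w, hw⟩⟩ - - h
    have := congrArg (fun x => x.1.1) h
    exact Finset.ne_of_mem_erase hw this
  · intros; simp
  · intros; rfl

/-- Every boundary is a cycle. -/
theorem simplicialBoundaries_le_cycles (K : Type*) [CommRing K] {V : Type*} [LinearOrder V]
    (Δ : PreAbstractSimplicialComplex V) (r : ℕ) :
    simplicialBoundaries K Δ r ≤ simplicialCycles K Δ r := by
  cases r with
  | zero => exact le_top
  | succ r => exact LinearMap.range_le_ker_iff.mpr (simplicialBoundary_comp K Δ r)

/-- The homology `H_r(Δ) = Z_r(Δ) / B_r(Δ)` with coefficients in `K`. -/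
abbrev SimplicialHomology (K : Type*) [CommRing K] {V : Type*} [LinearOrder V]
    (Δ : PreAbstractSimplicialComplex V) (r : ℕ) : Type _ :=
  simplicialCycles K Δ r ⧸ (simplicialBoundaries K Δ r).submoduleOf (simplicialCycles K Δ r)

end SimplicialHomology

/-! ### The total simplicial complex of a graph -/

section TotalSimplicialComplex

/-- The vertex set `V(G) ∪ E(G)` (disjoint union) of the total simplicial complex. -/
abbrev TotalVertex {V : Type*} (G : SimpleGraph V) : Type _ := V ⊕ G.edgeSet

/-- The total indices of `G`. Three vertices `p, q, r` (three edges `e, f, g`) count as adjacent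
when they can be listed so that consecutive ones are adjacent. -/
inductive IsTotalIndex {V : Type*} (G : SimpleGraph V) : Finset (TotalVertex G) → Prop
  /-- three adjacent vertices -/
  | vertices (σ : Finset (TotalVertex G)) (p q r : V) (hpr : p ≠ r)
      (hpq : G.Adj p q) (hqr : G.Adj q r)
      (hσ : (σ : Set (TotalVertex G)) = {Sum.inl p, Sum.inl q, Sum.inl r}) : IsTotalIndex G σ
  /-- three adjacent edges -/
  | edges (σ : Finset (TotalVertex G)) (e f g : G.edgeSet) (heg : e ≠ g)
      (hef : G.lineGraph.Adj e f) (hfg : G.lineGraph.Adj f g)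
      (hσ : (σ : Set (TotalVertex G)) = {Sum.inr e, Sum.inr f, Sum.inr g}) : IsTotalIndex G σ
  /-- two adjacent vertices and an edge incident to one of them -/
  | vertexVertexEdge (σ : Finset (TotalVertex G)) (p q : V) (e : G.edgeSet)
      (hpq : G.Adj p q) (he : p ∈ (e : Sym2 V) ∨ q ∈ (e : Sym2 V))
      (hσ : (σ : Set (TotalVertex G)) = {Sum.inl p, Sum.inl q, Sum.inr e}) : IsTotalIndex G σ
  /-- two adjacent edges and a vertex incident to one of them -/
  | edgeEdgeVertex (σ : Finset (TotalVertex G)) (e f : G.edgeSet) (v : V)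
      (hef : G.lineGraph.Adj e f) (hv : v ∈ (e : Sym2 V) ∨ v ∈ (f : Sym2 V))
      (hσ : (σ : Set (TotalVertex G)) = {Sum.inr e, Sum.inr f, Sum.inl v}) : IsTotalIndex G σ
  /-- an isolated vertex -/
  | isolated (σ : Finset (TotalVertex G)) (v : V) (hv : ∀ w, ¬ G.Adj v w)
      (hσ : (σ : Set (TotalVertex G)) = {Sum.inl v}) : IsTotalIndex G σ

/-- The total simplicial complex `Δ_T(G)`: the complex generated by the total indices of `G`. -/
def totalSimplicialComplex {V : Type*} (G : SimpleGraph V) :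
    PreAbstractSimplicialComplex (TotalVertex G) where
  faces := {s | s.Nonempty ∧ ∃ σ, IsTotalIndex G σ ∧ s ⊆ σ}
  isRelLowerSet_faces := by
    rintro s ⟨hs, σ, hσ, hsσ⟩
    exact ⟨hs, fun t hts ht => ⟨ht, σ, hσ, Finset.Subset.trans hts hsσ⟩⟩

end TotalSimplicialComplex

/-- The friendship graph with `2 n + 1` vertices and `3 n` edges: `n` triangles sharing the common
vertex `none`; the other two vertices of the `i`-th triangle are `some (i, false)` and
`some (i, true)`. -/
def friendshipGraph (n : ℕ) : SimpleGraph (Option (Fin n × Bool)) where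
  Adj a b := a ≠ b ∧ (a = none ∨ b = none ∨ a.map Prod.fst = b.map Prod.fst)
  symm := ⟨fun _ _ h => ⟨h.1.symm, by
    rcases h.2 with h | h | h
    exacts [Or.inr (Or.inl h), Or.inl h, Or.inr (Or.inr h.symm)]⟩⟩
  loopless := ⟨fun _ h => h.1 rfl⟩

/-! Write c for the central vertex of the graph. Since n ≥ 1 no vertex is isolated, so every
generator of the complex is a triple: the complex is pure of dimension two, and homology vanishes
from degree 3 on.

The cell c is joined by an edge to every other cell, which gives H_0 = K: the 0-boundaries are the
kernel of the augmentation (`simplicialBoundaries_zero_eq_ker`).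

The complex is not a cone over c, but it behaves like one on 1-chains. For every edge uv the closed
path c → u → v → c bounds. Usually {c, u, v} is itself a face; the exception is the edge opposite to
c in one triangle paired with an edge at c from another, where three faces together fill the path
(`cone_cycle_mem_boundaries`). Coning off the boundary of a 1-cycle then shows that the cycle
bounds, so H_1 = 0 (`simplicialCycles_one_le_boundaries`).

Finally H_2 is read off from the Euler characteristic (`nonempty_simplicialHomology_two_equiv`). The
face numbers are f_0 = 5n + 1, f_1 = 10n² + 5n and 3 f_2 = 4n³ + 42n² + 14n, so β₂ = f_2 - f_1 + f_0
- 1 = f_2 - 10n². The counts come from explicit bijective codes for edges and facets. -/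

/-! ### Low-degree homology by coning from a vertex -/

section ConeHomology

variable {K : Type*} [CommRing K] {V : Type*}
  {Δ : PreAbstractSimplicialComplex V}

open Classical in
/-- The basis chain of `s`, extended by zero to the sets that are not `r`-dimensional faces. -/
noncomputable def faceChain (K : Type*) [CommRing K] {V : Type*}
    (Δ : PreAbstractSimplicialComplex V) (r : ℕ) (s : Finset V) : SimplicialChain K Δ r :=
  if h : s ∈ Δ.faces ∧ s.card = r + 1 then SimplicialChain.basis K Δ r ⟨s, h⟩ else 0

theorem faceChain_coe (r : ℕ) (σ : FacesOfDim Δ r) :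
    faceChain K Δ r σ.1 = SimplicialChain.basis K Δ r σ :=
  dif_pos σ.2

theorem singleton_mem_faces_of_mem {s : Finset V} (hs : s ∈ Δ.faces) {v : V} (hv : v ∈ s) :
    {v} ∈ Δ.faces :=
  (Δ.isRelLowerSet_faces hs).2 (by simpa using hv) (Finset.singleton_nonempty v)

theorem subsingleton_simplicialChain {r : ℕ} (h : IsEmpty (FacesOfDim Δ r)) :
    Subsingleton (SimplicialChain K Δ r) :=
  inferInstanceAs (Subsingleton (FacesOfDim Δ r →₀ K))

/-- The augmentation of the `0`-chains. -/
noncomputable def chainAugmentation (K : Type*) [CommRing K] {V : Type*}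
    (Δ : PreAbstractSimplicialComplex V) : SimplicialChain K Δ 0 →ₗ[K] K :=
  (SimplicialChain.basis K Δ 0).constr K fun _ => 1

theorem chainAugmentation_faceChain {v : V} (hv : {v} ∈ Δ.faces) :
    chainAugmentation K Δ (faceChain K Δ 0 {v}) = 1 := by
  rw [faceChain_coe 0 ⟨{v}, hv, Finset.card_singleton v⟩, chainAugmentation,
    Module.Basis.constr_basis]

variable [LinearOrder V]

theorem simplicialBoundary_faceChain {r : ℕ} {s : Finset V} (hs : s ∈ Δ.faces)
    (hc : s.card = r + 1 + 1) :
    simplicialBoundary K Δ r (faceChain K Δ (r + 1) s) =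
      ∑ v ∈ s, (-1 : K) ^ vertexPosition s v • faceChain K Δ r (s.erase v) := by
  rw [faceChain_coe (r + 1) ⟨s, hs, hc⟩, simplicialBoundary, Module.Basis.constr_basis,
    ← Finset.sum_attach s]
  refine Finset.sum_congr rfl fun v _ => ?_
  rw [← faceChain_coe]
  rfl

/-- The oriented edge from `u` to `v`. -/
noncomputable def orientedEdge (K : Type*) [CommRing K] {V : Type*} [LinearOrder V]
    (Δ : PreAbstractSimplicialComplex V) (u v : V) : SimplicialChain K Δ 1 :=
  if u < v then faceChain K Δ 1 {u, v} else if v < u then -faceChain K Δ 1 {u, v} else 0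

theorem orientedEdge_self (u : V) : orientedEdge K Δ u u = 0 := by
  simp [orientedEdge]

theorem orientedEdge_of_lt {u v : V} (h : u < v) :
    orientedEdge K Δ u v = faceChain K Δ 1 {u, v} := if_pos h

theorem orientedEdge_symm (u v : V) : orientedEdge K Δ u v = -orientedEdge K Δ v u := by
  rcases lt_trichotomy u v with h | rfl | h
  · simp [orientedEdge, h, h.not_gt, Finset.pair_comm]
  · simp [orientedEdge]
  · simp [orientedEdge, h, h.not_gt, Finset.pair_comm]

/-- Antisymmetry of oriented edges absorbs the sign coming from the arbitrary vertex order. The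
degenerate case u = v is included, both sides being zero. -/
theorem simplicialBoundary_orientedEdge {u v : V} (h : {u, v} ∈ Δ.faces) :
    simplicialBoundary K Δ 0 (orientedEdge K Δ u v) =
      faceChain K Δ 0 {v} - faceChain K Δ 0 {u} := by
  wlog huv : u < v generalizing u v
  · rcases (not_lt.mp huv).eq_or_lt with rfl | hlt
    · simp [orientedEdge_self]
    · rw [orientedEdge_symm, map_neg, this (by rwa [Finset.pair_comm]) hlt, neg_sub]
  rw [orientedEdge_of_lt huv,
    simplicialBoundary_faceChain h (by rw [Finset.card_pair huv.ne]), Finset.sum_pair huv.ne]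
  have h1 : vertexPosition {u, v} u = 0 := by
    simp [vertexPosition, Finset.filter_insert, Finset.filter_singleton, huv.not_gt]
  have h2 : vertexPosition {u, v} v = 1 := by
    simp [vertexPosition, Finset.filter_insert, Finset.filter_singleton, huv]
  have h3 : ({u, v} : Finset V).erase u = {v} := by
    rw [Finset.erase_insert (by simpa using huv.ne)]
  have h4 : ({u, v} : Finset V).erase v = {u} := by
    rw [Finset.pair_comm, Finset.erase_insert (by simpa using huv.ne')]
  rw [h1, h2, h3, h4]
  simp [sub_eq_add_neg]

/-- The boundary of a triangle bounds. -/
theorem orientedEdge_cycle_mem_boundaries {u v w : V} (h : {u, v, w} ∈ Δ.faces) :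
    orientedEdge K Δ u v + orientedEdge K Δ v w + orientedEdge K Δ w u ∈
      simplicialBoundaries K Δ 1 := by
  -- For increasing vertices this is the boundary formula itself. The rotation and the transposition
  -- below generate all orderings, and when two vertices coincide the sum is zero.
  have key : ∀ a b c : V, a < b → b < c → {a, b, c} ∈ Δ.faces →
      orientedEdge K Δ a b + orientedEdge K Δ b c + orientedEdge K Δ c a ∈
        simplicialBoundaries K Δ 1 := by
    intro a b c hab hbc hf
    have hac := hab.trans hbc
    refine ⟨faceChain K Δ 2 {a, b, c}, ?_⟩
    have hcard : ({a, b, c} : Finset V).card = 3 := Finset.card_eq_three.mpr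
      ⟨a, b, c, hab.ne, hac.ne, hbc.ne, rfl⟩
    rw [simplicialBoundary_faceChain hf hcard,
      Finset.sum_insert (by simp [hab.ne, hac.ne]), Finset.sum_pair hbc.ne]
    have h1 : vertexPosition {a, b, c} a = 0 := by
      simp [vertexPosition, Finset.filter_insert, Finset.filter_singleton, hab.not_gt, hac.not_gt]
    have h2 : vertexPosition {a, b, c} b = 1 := by
      simp [vertexPosition, Finset.filter_insert, Finset.filter_singleton, hab, hbc.not_gt]
    have h3 : vertexPosition {a, b, c} c = 2 := by
      simp [vertexPosition, Finset.filter_insert, Finset.filter_singleton, hbc, hac, hab.ne]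
    have h4 : ({a, b, c} : Finset V).erase a = {b, c} := by
      rw [Finset.erase_insert (by simp [hab.ne, hac.ne])]
    have h5 : ({a, b, c} : Finset V).erase b = {a, c} := by
      rw [Finset.insert_comm, Finset.erase_insert (by simp [hab.ne', hbc.ne])]
    have h6 : ({a, b, c} : Finset V).erase c = {a, b} := by
      rw [Finset.pair_comm b, Finset.insert_comm,
        Finset.erase_insert (by simp [hac.ne', hbc.ne'])]
    rw [h1, h2, h3, h4, h5, h6, orientedEdge_symm c a, orientedEdge_of_lt hab,
      orientedEdge_of_lt hbc, orientedEdge_of_lt hac]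
    simp only [pow_zero, one_smul, pow_one, neg_smul, even_two, Even.neg_pow, one_pow]
    abel
  have rot : ∀ {a b c : V}, orientedEdge K Δ a b + orientedEdge K Δ b c + orientedEdge K Δ c a ∈
        simplicialBoundaries K Δ 1 →
      orientedEdge K Δ b c + orientedEdge K Δ c a + orientedEdge K Δ a b ∈
        simplicialBoundaries K Δ 1 := by
    intro a b c h
    convert h using 1
    abel
  have swap : ∀ {a b c : V}, orientedEdge K Δ a b + orientedEdge K Δ b c + orientedEdge K Δ c a ∈
        simplicialBoundaries K Δ 1 →
      orientedEdge K Δ b a + orientedEdge K Δ a c + orientedEdge K Δ c b ∈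
        simplicialBoundaries K Δ 1 := by
    intro a b c h
    convert neg_mem h using 1
    rw [orientedEdge_symm b a, orientedEdge_symm a c, orientedEdge_symm c b]
    abel
  have perm1 : ({v, w, u} : Finset V) = {u, v, w} := by ext; simp; tauto
  have perm2 : ({w, u, v} : Finset V) = {u, v, w} := by ext; simp; tauto
  have perm3 : ({v, u, w} : Finset V) = {u, v, w} := by ext; simp; tauto
  have perm4 : ({u, w, v} : Finset V) = {u, v, w} := by ext; simp; tauto
  have perm5 : ({w, v, u} : Finset V) = {u, v, w} := by ext; simp; tauto
  rcases lt_trichotomy u v with huv | rfl | huv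
  · rcases lt_trichotomy v w with hvw | rfl | hvw
    · exact key _ _ _ huv hvw h
    · simp [orientedEdge_self, orientedEdge_symm u]
    · rcases lt_trichotomy u w with huw | rfl | huw
      · exact rot (swap (key _ _ _ huw hvw (perm4 ▸ h)))
      · simp [orientedEdge_self, orientedEdge_symm u]
      · exact rot (key _ _ _ huw huv (perm2 ▸ h))
  · simp [orientedEdge_self, orientedEdge_symm u]
  · rcases lt_trichotomy u w with huw | rfl | huw
    · exact swap (key _ _ _ huv huw (perm3 ▸ h))
    · simp [orientedEdge_self, orientedEdge_symm u]
    · rcases lt_trichotomy v w with hvw | rfl | hvw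
      · exact rot (rot (key _ _ _ hvw huw (perm1 ▸ h)))
      · simp [orientedEdge_self, orientedEdge_symm u]
      · exact rot (rot (swap (key _ _ _ hvw huv (perm5 ▸ h))))

/-- Allows linear maps on 1-chains to be compared on oriented edges, with no further reference to
the vertex order. -/
theorem faceChain_eq_orientedEdge (σ : FacesOfDim Δ 1) : ∃ u v, {u, v} ∈ Δ.faces ∧
    SimplicialChain.basis K Δ 1 σ = orientedEdge K Δ u v := by
  obtain ⟨u, v, huv, hσ⟩ := Finset.card_eq_two.mp σ.2.2
  have hf := σ.2.1
  rw [← faceChain_coe, hσ]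
  rw [hσ] at hf
  rcases lt_or_gt_of_ne huv with h | h
  · exact ⟨u, v, hf, (orientedEdge_of_lt h).symm⟩
  · exact ⟨v, u, by rwa [Finset.pair_comm], by rw [orientedEdge_of_lt h, Finset.pair_comm]⟩

/-- The homomorphism `C_0 → C_1` sending a vertex `v` to the edge from `c` to `v`. -/
noncomputable def coneEdge (K : Type*) [CommRing K] {V : Type*} [LinearOrder V]
    (Δ : PreAbstractSimplicialComplex V) (c : V) :
    SimplicialChain K Δ 0 →ₗ[K] SimplicialChain K Δ 1 :=
  (SimplicialChain.basis K Δ 0).constr K fun σ => ∑ v ∈ σ.1, orientedEdge K Δ c v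

theorem coneEdge_faceChain (c : V) {v : V} (hv : {v} ∈ Δ.faces) :
    coneEdge K Δ c (faceChain K Δ 0 {v}) = orientedEdge K Δ c v := by
  rw [faceChain_coe 0 ⟨{v}, hv, Finset.card_singleton v⟩, coneEdge, Module.Basis.constr_basis]
  simp

/-- The map z ↦ z - cone(∂z) sends the edge uv to the closed path c → u → v → c, so by hypothesis
its image consists of boundaries; on cycles it is the identity. The triangle {c, u, v} need not be a
face. -/
theorem simplicialCycles_one_le_boundaries (c : V)
    (hc : ∀ u v, {u, v} ∈ Δ.faces → orientedEdge K Δ c u + orientedEdge K Δ u v +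
      orientedEdge K Δ v c ∈ simplicialBoundaries K Δ 1) :
    simplicialCycles K Δ 1 ≤ simplicialBoundaries K Δ 1 := by
  have key : ∀ z, z - coneEdge K Δ c (simplicialBoundary K Δ 0 z) ∈
      simplicialBoundaries K Δ 1 := by
    have h : (simplicialBoundaries K Δ 1).mkQ ∘ₗ
        (LinearMap.id - coneEdge K Δ c ∘ₗ simplicialBoundary K Δ 0) = 0 := by
      refine (SimplicialChain.basis K Δ 1).ext fun σ => ?_
      obtain ⟨u, v, hf, hσ⟩ := faceChain_eq_orientedEdge (K := K) σ
      rw [hσ, LinearMap.comp_apply, LinearMap.zero_apply, Submodule.mkQ_apply,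
        Submodule.Quotient.mk_eq_zero, LinearMap.sub_apply, LinearMap.id_apply,
        LinearMap.comp_apply, simplicialBoundary_orientedEdge hf, map_sub,
        coneEdge_faceChain c (singleton_mem_faces_of_mem hf (by simp)),
        coneEdge_faceChain c (singleton_mem_faces_of_mem hf (by simp))]
      convert hc u v hf using 1
      rw [orientedEdge_symm v c]
      abel
    exact fun z => (Submodule.Quotient.mk_eq_zero _).mp (LinearMap.congr_fun h z)
  intro z hz
  have := key z
  rwa [show simplicialBoundary K Δ 0 z = 0 from hz, map_zero, sub_zero] at this

/-- Each vertex v differs from c by the boundary of the edge c → v, so a 0-chain is its augmentation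
times c modulo boundaries. -/
theorem simplicialBoundaries_zero_eq_ker (c : V)
    (hc : ∀ v, {v} ∈ Δ.faces → {c, v} ∈ Δ.faces) :
    simplicialBoundaries K Δ 0 = LinearMap.ker (chainAugmentation K Δ) := by
  apply le_antisymm
  · refine LinearMap.range_le_ker_iff.mpr ((SimplicialChain.basis K Δ 1).ext fun σ => ?_)
    obtain ⟨u, v, hf, hσ⟩ := faceChain_eq_orientedEdge (K := K) σ
    rw [hσ, LinearMap.comp_apply, simplicialBoundary_orientedEdge hf, map_sub,
      chainAugmentation_faceChain (singleton_mem_faces_of_mem hf (by simp)),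
      chainAugmentation_faceChain (singleton_mem_faces_of_mem hf (by simp))]
    simp
  · have key : ∀ z, z - chainAugmentation K Δ z • faceChain K Δ 0 {c} ∈
        simplicialBoundaries K Δ 0 := by
      have h : (simplicialBoundaries K Δ 0).mkQ ∘ₗ (LinearMap.id -
          (chainAugmentation K Δ).smulRight (faceChain K Δ 0 {c})) = 0 := by
        refine (SimplicialChain.basis K Δ 0).ext fun σ => ?_
        obtain ⟨v, hσ⟩ := Finset.card_eq_one.mp σ.2.2
        have hv := σ.2.1
        rw [← faceChain_coe, hσ]
        rw [hσ] at hv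
        rw [LinearMap.comp_apply, LinearMap.zero_apply, Submodule.mkQ_apply,
          Submodule.Quotient.mk_eq_zero, LinearMap.sub_apply, LinearMap.id_apply,
          LinearMap.smulRight_apply, chainAugmentation_faceChain hv, one_smul]
        exact ⟨_, simplicialBoundary_orientedEdge (hc v hv)⟩
      exact fun z => (Submodule.Quotient.mk_eq_zero _).mp (LinearMap.congr_fun h z)
    intro z hz
    have := key z
    rwa [show chainAugmentation K Δ z = 0 from hz, zero_smul, sub_zero] at this

/-- A nonempty complex all of whose vertices are joined to `c` has `H_0 = K`. -/
theorem nonempty_simplicialHomology_zero_equiv (c : V) (hcΔ : {c} ∈ Δ.faces)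
    (hc : ∀ v, {v} ∈ Δ.faces → {c, v} ∈ Δ.faces) :
    Nonempty (SimplicialHomology K Δ 0 ≃ₗ[K] K) := by
  have hk : (simplicialBoundaries K Δ 0).submoduleOf (simplicialCycles K Δ 0) =
      LinearMap.ker (chainAugmentation K Δ ∘ₗ (simplicialCycles K Δ 0).subtype) := by
    rw [simplicialBoundaries_zero_eq_ker c hc, LinearMap.ker_comp]
    rfl
  refine ⟨(Submodule.quotEquivOfEq _ _ hk).trans (LinearMap.quotKerEquivOfSurjective _ ?_)⟩
  intro a
  refine ⟨⟨a • faceChain K Δ 0 {c}, Submodule.mem_top⟩, ?_⟩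
  simp [chainAugmentation_faceChain hcΔ]

theorem subsingleton_simplicialHomology_of_le {r : ℕ}
    (h : simplicialCycles K Δ r ≤ simplicialBoundaries K Δ r) :
    Subsingleton (SimplicialHomology K Δ r) := by
  rw [Submodule.Quotient.subsingleton_iff]
  exact Submodule.comap_subtype_eq_top.mpr h

theorem subsingleton_simplicialHomology_of_isEmpty {r : ℕ} (h : IsEmpty (FacesOfDim Δ r)) :
    Subsingleton (SimplicialHomology K Δ r) :=
  have := subsingleton_simplicialChain (K := K) h
  subsingleton_simplicialHomology_of_le fun z _ =>
    Subsingleton.elim (0 : SimplicialChain K Δ r) z ▸ zero_mem _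

end ConeHomology

/-! ### The second Betti number from the Euler characteristic -/

/-- The Euler characteristic of a two-dimensional complex with `H_0 = K` and `H_1 = 0` determines
`H_2`. -/
theorem nonempty_simplicialHomology_two_equiv {K : Type*} [Field K] {V : Type*} [LinearOrder V]
    [Finite V] {Δ : PreAbstractSimplicialComplex V}
    (h0 : Nonempty (SimplicialHomology K Δ 0 ≃ₗ[K] K))
    (h1 : simplicialCycles K Δ 1 ≤ simplicialBoundaries K Δ 1)
    (h3 : IsEmpty (FacesOfDim Δ 3)) {β : ℕ}
    (hβ : Nat.card (FacesOfDim Δ 0) + Nat.card (FacesOfDim Δ 2) =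
      β + 1 + Nat.card (FacesOfDim Δ 1)) :
    Nonempty (SimplicialHomology K Δ 2 ≃ₗ[K] (Fin β → K)) := by
  have hfin : ∀ r, Module.Finite K (SimplicialChain K Δ r) := fun r =>
    Module.Finite.of_basis (SimplicialChain.basis K Δ r)
  have hrank : ∀ r, Module.finrank K (SimplicialChain K Δ r) = Nat.card (FacesOfDim Δ r) :=
    fun r => Module.finrank_eq_nat_card_basis (SimplicialChain.basis K Δ r)
  have e0 : Module.finrank K (simplicialBoundaries K Δ 0) +
      Module.finrank K (simplicialCycles K Δ 1) = Nat.card (FacesOfDim Δ 1) :=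
    (LinearMap.finrank_range_add_finrank_ker (simplicialBoundary K Δ 0)).trans (hrank 1)
  have e1 : Module.finrank K (simplicialBoundaries K Δ 1) +
      Module.finrank K (simplicialCycles K Δ 2) = Nat.card (FacesOfDim Δ 2) :=
    (LinearMap.finrank_range_add_finrank_ker (simplicialBoundary K Δ 1)).trans (hrank 2)
  -- Vanishing of H_1 turns this into dim Z_1 + dim Z_2 = f_2. With dim B_0 = f_0 - 1, dim B_0 + dim
  -- Z_1 = f_1 and B_2 = 0, this determines dim H_2.
  rw [le_antisymm (simplicialBoundaries_le_cycles K Δ 1) h1] at e1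
  have c0 : Module.finrank K (simplicialCycles K Δ 0) = Nat.card (FacesOfDim Δ 0) :=
    (finrank_top K _).trans (hrank 0)
  have d : ∀ r, Module.finrank K (SimplicialHomology K Δ r) +
      Module.finrank K (simplicialBoundaries K Δ r) = Module.finrank K (simplicialCycles K Δ r) :=
    fun r => by
      rw [← (Submodule.submoduleOfEquivOfLe (simplicialBoundaries_le_cycles K Δ r)).finrank_eq]
      exact Submodule.finrank_quotient_add_finrank _
  have d0 := d 0
  rw [h0.some.finrank_eq, Module.finrank_self] at d0
  have b2 : Module.finrank K (simplicialBoundaries K Δ 2) = 0 := by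
    have := subsingleton_simplicialChain (K := K) h3
    rw [show simplicialBoundaries K Δ 2 = ⊥ from LinearMap.range_eq_bot.mpr
        (LinearMap.ext fun z => by rw [Subsingleton.elim z 0]; simp), finrank_bot]
  have d2 := d 2
  refine ⟨LinearEquiv.ofFinrankEq _ _ ?_⟩
  rw [Module.finrank_fin_fun]
  omega

/-! ### A model of the vertex set, and the list of facets -/

section FriendshipFacets

/-- A model of the vertex set of the total complex of the friendship graph: `side (Sum.inl l)` is
the outer vertex `l`, `side (Sum.inr l)` is the edge joining it to the center, and `rim i` is the
edge of the `i`-th triangle opposite to the center. -/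
inductive FriendshipCell (n : ℕ) : Type
  | center : FriendshipCell n
  | side (u : (Fin n × Bool) ⊕ (Fin n × Bool)) : FriendshipCell n
  | rim (i : Fin n) : FriendshipCell n
  deriving DecidableEq

namespace FriendshipCell

variable {n : ℕ}

/-- The outer vertices. -/
abbrev leaf (l : Fin n × Bool) : FriendshipCell n := side (Sum.inl l)

/-- The edges at the center. -/
abbrev spoke (l : Fin n × Bool) : FriendshipCell n := side (Sum.inr l)

theorem side_injective : Function.Injective (side : _ → FriendshipCell n) :=
  fun _ _ h => by simpa using h

theorem spoke_injective : Function.Injective (spoke : _ → FriendshipCell n) :=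
  fun _ _ h => by simpa using h

/-- The triangle of a cell other than the center. -/
def triangle : (Fin n × Bool) ⊕ (Fin n × Bool) → Fin n := Sum.elim Prod.fst Prod.fst

/-- The edge `l` at the center. -/
def spokeEdge (l : Fin n × Bool) : (friendshipGraph n).edgeSet :=
  ⟨s(none, some l), by simp [friendshipGraph]⟩

/-- The `i`-th edge not at the center. -/
def rimEdge (i : Fin n) : (friendshipGraph n).edgeSet :=
  ⟨s(some (i, false), some (i, true)), by simp [friendshipGraph]⟩

theorem edge_cases (e : (friendshipGraph n).edgeSet) :
    (∃ l, e = spokeEdge l) ∨ ∃ i, e = rimEdge i := by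
  obtain ⟨e, he⟩ := e
  induction e using Sym2.ind with
  | _ a b =>
    obtain ⟨hne, h⟩ := he
    rcases a with _ | ⟨i, x⟩
    · rcases b with _ | m
      · exact absurd rfl hne
      · exact Or.inl ⟨m, rfl⟩
    · rcases b with _ | ⟨j, y⟩
      · exact Or.inl ⟨(i, x), Subtype.ext Sym2.eq_swap⟩
      · obtain rfl : i = j := by simpa using h
        refine Or.inr ⟨i, Subtype.ext ?_⟩
        cases x <;> cases y
        · exact absurd rfl hne
        · rfl
        · exact Sym2.eq_swap
        · exact absurd rfl hne

@[simp] theorem mem_spokeEdge (v : Option (Fin n × Bool)) (l : Fin n × Bool) :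
    v ∈ (spokeEdge l : Sym2 (Option (Fin n × Bool))) ↔ v = none ∨ v = some l := by
  simp [spokeEdge]

@[simp] theorem mem_rimEdge (v : Option (Fin n × Bool)) (i : Fin n) :
    v ∈ (rimEdge i : Sym2 (Option (Fin n × Bool))) ↔ ∃ b, v = some (i, b) := by
  simp [rimEdge]

@[simp] theorem spokeEdge_inj (l m : Fin n × Bool) : spokeEdge l = spokeEdge m ↔ l = m := by
  rw [← Subtype.val_inj]
  simp [spokeEdge]

@[simp] theorem rimEdge_inj (i j : Fin n) : rimEdge i = rimEdge j ↔ i = j := by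
  rw [← Subtype.val_inj]
  simp [rimEdge]

@[simp] theorem spokeEdge_ne_rimEdge (l : Fin n × Bool) (i : Fin n) :
    spokeEdge l ≠ rimEdge i := by
  rw [ne_eq, ← Subtype.val_inj]
  simp [spokeEdge, rimEdge]

@[simp] theorem rimEdge_ne_spokeEdge (l : Fin n × Bool) (i : Fin n) :
    rimEdge i ≠ spokeEdge l := (spokeEdge_ne_rimEdge l i).symm

theorem lineGraph_adj_iff (e f : (friendshipGraph n).edgeSet) :
    (friendshipGraph n).lineGraph.Adj e f ↔
      e ≠ f ∧ ∃ v, v ∈ (e : Sym2 (Option (Fin n × Bool))) ∧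
        v ∈ (f : Sym2 (Option (Fin n × Bool))) := by
  simp [SimpleGraph.lineGraph, Set.Nonempty]

@[simp] theorem adj_spoke_spoke (l m : Fin n × Bool) :
    (friendshipGraph n).lineGraph.Adj (spokeEdge l) (spokeEdge m) ↔ l ≠ m := by
  simp only [lineGraph_adj_iff, ne_eq, spokeEdge_inj, mem_spokeEdge, and_iff_left_iff_imp]
  exact fun _ => ⟨none, by simp⟩

@[simp] theorem adj_rim_spoke (l : Fin n × Bool) (i : Fin n) :
    (friendshipGraph n).lineGraph.Adj (rimEdge i) (spokeEdge l) ↔ l.1 = i := by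
  simp only [lineGraph_adj_iff, ne_eq, rimEdge_ne_spokeEdge, mem_spokeEdge, mem_rimEdge]
  constructor
  · rintro ⟨-, v, ⟨b, rfl⟩, h⟩
    simp at h
    rw [← h]
  · rintro rfl
    exact ⟨not_false, some l, ⟨l.2, rfl⟩, Or.inr rfl⟩

@[simp] theorem adj_spoke_rim (l : Fin n × Bool) (i : Fin n) :
    (friendshipGraph n).lineGraph.Adj (spokeEdge l) (rimEdge i) ↔ l.1 = i := by
  rw [SimpleGraph.adj_comm, adj_rim_spoke]

@[simp] theorem not_adj_rim_rim (i j : Fin n) :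
    ¬ (friendshipGraph n).lineGraph.Adj (rimEdge i) (rimEdge j) := by
  simp only [lineGraph_adj_iff, ne_eq, rimEdge_inj, mem_rimEdge]
  rintro ⟨h, v, ⟨b, rfl⟩, ⟨c, hc⟩⟩
  simp at hc
  exact h hc.1

@[simp] theorem adj_none_some (l : Fin n × Bool) :
    (friendshipGraph n).Adj none (some l) := by
  simp [friendshipGraph]

@[simp] theorem adj_some_none (l : Fin n × Bool) :
    (friendshipGraph n).Adj (some l) none := by
  simp [friendshipGraph]

@[simp] theorem adj_some_some (l m : Fin n × Bool) :
    (friendshipGraph n).Adj (some l) (some m) ↔ l ≠ m ∧ l.1 = m.1 := by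
  simp [friendshipGraph]

/-- The vertex of the total complex modelled by a cell. -/
def toTotal : FriendshipCell n → TotalVertex (friendshipGraph n)
  | center => Sum.inl none
  | side (Sum.inl l) => Sum.inl (some l)
  | side (Sum.inr l) => Sum.inr (spokeEdge l)
  | rim i => Sum.inr (rimEdge i)

theorem toTotal_bijective : Function.Bijective (toTotal (n := n)) := by
  constructor
  · rintro (_ | (l | l) | i) (_ | (m | m) | j) h <;> simp_all [toTotal]
  · rintro ((_ | l) | e)
    · exact ⟨center, rfl⟩
    · exact ⟨leaf l, rfl⟩
    · rcases edge_cases e with ⟨l, rfl⟩ | ⟨i, rfl⟩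
      · exact ⟨spoke l, rfl⟩
      · exact ⟨rim i, rfl⟩

/-- The cells are the vertices of the total complex. -/
noncomputable def totalEquiv : FriendshipCell n ≃ TotalVertex (friendshipGraph n) :=
  Equiv.ofBijective toTotal toTotal_bijective

@[simp] theorem totalEquiv_center : totalEquiv (center : FriendshipCell n) = Sum.inl none := rfl

@[simp] theorem totalEquiv_leaf (l : Fin n × Bool) :
    totalEquiv (leaf l) = Sum.inl (some l) := rfl

@[simp] theorem totalEquiv_spoke (l : Fin n × Bool) :
    totalEquiv (spoke l) = Sum.inr (spokeEdge l) := rfl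

@[simp] theorem totalEquiv_rim (i : Fin n) : totalEquiv (rim i) = Sum.inr (rimEdge i) := rfl

/-- A code for the facets. -/
abbrev FacetIndex (n : ℕ) : Type :=
  {s : Finset ((Fin n × Bool) ⊕ (Fin n × Bool)) // s.card = 2} ⊕
  ((Fin n × Bool) ⊕ (Fin n × Bool)) ⊕
  {s : Finset (Fin n × Bool) // s.card = 3} ⊕
  (Fin n × Bool) ⊕
  {p : (Fin n × Bool) × (Fin n × Bool) // p.1 ≠ p.2} ⊕
  Fin n ⊕
  (Fin n × Bool × Bool) ⊕
  Fin n ⊕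
  {p : (Fin n × Bool) × (Fin n × Bool) // p.1.1 ≠ p.2.1}

/-- The facets of the total complex of the friendship graph. -/
def facet : FacetIndex n → Finset (FriendshipCell n) :=
  Sum.elim (fun s => insert center (s.1.map ⟨side, side_injective⟩)) <|
  Sum.elim (fun u => {center, rim (triangle u), side u}) <|
  Sum.elim (fun s => s.1.map ⟨spoke, spoke_injective⟩) <|
  Sum.elim (fun l => {leaf l, leaf (l.1, !l.2), spoke l}) <|
  Sum.elim (fun p => {leaf p.1.1, spoke p.1.1, spoke p.1.2}) <|
  Sum.elim (fun i => {rim i, leaf (i, false), leaf (i, true)}) <|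
  Sum.elim (fun p => {rim p.1, leaf (p.1, p.2.1), spoke (p.1, p.2.2)}) <|
  Sum.elim (fun i => {rim i, spoke (i, false), spoke (i, true)}) <|
  fun p => {rim p.1.1.1, spoke p.1.1, spoke p.1.2}

theorem facet_card (a : FacetIndex n) : (facet a).card = 3 := by
  rcases a with s | u | s | l | p | i | p | i | p
  · simp [facet, s.2]
  · simp [facet]
  · simp [facet, s.2]
  · obtain ⟨i, b⟩ := l
    cases b <;> simp [facet]
  · simp [facet, p.2]
  · simp [facet]
  · simp [facet]
  · simp [facet]
  · have : p.1.1 ≠ p.1.2 := fun h => p.2 (congrArg Prod.fst h)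
    simp [facet, this]

/-- The families differ in how many centers, rims, leaves and spokes their members contain. Only the
last two share a shape, a rim with two spokes; they differ in whether both spokes lie in the
triangle of the rim. -/
theorem facet_injective : Function.Injective (facet (n := n)) := by
  refine Function.Injective.sumElim ?_ (Function.Injective.sumElim ?_
    (Function.Injective.sumElim ?_ (Function.Injective.sumElim ?_
    (Function.Injective.sumElim ?_ (Function.Injective.sumElim ?_
    (Function.Injective.sumElim ?_ (Function.Injective.sumElim ?_ ?_ ?_) ?_) ?_) ?_) ?_) ?_) ?_) ?_
  · intro s t h
    refine Subtype.ext (Finset.map_injective ⟨side, side_injective⟩ ?_)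
    have := congrArg (fun s => Finset.erase s center) h
    simpa using this
  · intro u v h
    simp [Finset.Subset.antisymm_iff, Finset.insert_subset_iff] at h
    exact h.1.2
  · intro s t h
    exact Subtype.ext (Finset.map_injective _ h)
  · intro l m h
    simp [Finset.Subset.antisymm_iff, Finset.insert_subset_iff] at h
    exact h.1.2.2
  · rintro ⟨⟨l, m⟩, hp⟩ ⟨⟨l', m'⟩, hp'⟩ h
    simp [Finset.Subset.antisymm_iff, Finset.insert_subset_iff] at h hp hp'
    grind
  · intro i j h
    simp [Finset.Subset.antisymm_iff, Finset.insert_subset_iff] at h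
    exact h.1
  · rintro ⟨i, b, c⟩ ⟨j, b', c'⟩ h
    simp [Finset.Subset.antisymm_iff, Finset.insert_subset_iff] at h
    grind
  · intro i j h
    simp [Finset.Subset.antisymm_iff, Finset.insert_subset_iff] at h
    exact h.1
  · rintro ⟨⟨l, m⟩, hp⟩ ⟨⟨l', m'⟩, hp'⟩ h
    simp [Finset.Subset.antisymm_iff, Finset.insert_subset_iff] at h hp hp'
    grind
  -- From here on the goals are disjointness of distinct families, starting with the two of equal
  -- shape.
  · rintro i ⟨⟨l, m⟩, hp⟩ h
    simp [Finset.Subset.antisymm_iff, Finset.insert_subset_iff] at h hp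
    grind
  · rintro p (q | q) h <;> simp [Finset.Subset.antisymm_iff, Finset.insert_subset_iff] at h
  · rintro p (q | q | q) h <;> simp [Finset.Subset.antisymm_iff, Finset.insert_subset_iff] at h
  · rintro p (q | q | q | q) h <;>
      simp [Finset.Subset.antisymm_iff, Finset.insert_subset_iff] at h
  · rintro p (q | q | q | q | q) h <;>
      simp [Finset.Subset.antisymm_iff, Finset.insert_subset_iff] at h
    grind
  · rintro p (q | q | q | q | q | q) h <;>
      simp [Finset.Subset.antisymm_iff, Finset.insert_subset_iff] at h
  · rintro p (q | q | q | q | q | q | q) h <;>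
      simp [Finset.Subset.antisymm_iff, Finset.insert_subset_iff] at h
  · rintro p (q | q | q | q | q | q | q | q) h <;>
      simp [Finset.Subset.antisymm_iff, Finset.insert_subset_iff] at h

/-- Leaves and spokes are coded by a single constructor because the center forms a facet with any
two of them. -/
theorem exists_facet_cone {u v : (Fin n × Bool) ⊕ (Fin n × Bool)} (h : u ≠ v) :
    ∃ a, facet a = {center, side u, side v} :=
  ⟨Sum.inl ⟨{u, v}, Finset.card_pair h⟩, by simp [facet]⟩

/-- Two codes are needed. With both spokes in the triangle of the rim the facet is symmetric in them
and is coded by the triangle alone; otherwise the rim tells which spoke comes first, and ordered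
pairs are counted. -/
theorem exists_facet_rim_spoke {l m : Fin n × Bool} (h : l ≠ m) :
    ∃ a, facet a = {rim l.1, spoke l, spoke m} := by
  by_cases hlm : l.1 = m.1
  · refine ⟨.inr (.inr (.inr (.inr (.inr (.inr (.inr (.inl l.1))))))), ?_⟩
    obtain ⟨i, b⟩ := l
    obtain ⟨j, c⟩ := m
    obtain rfl : i = j := hlm
    cases b <;> cases c <;> simp_all [facet, Finset.pair_comm]
  · exact ⟨.inr (.inr (.inr (.inr (.inr (.inr (.inr (.inr ⟨(l, m), hlm⟩))))))), rfl⟩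

theorem exists_facet_center_rim (u : (Fin n × Bool) ⊕ (Fin n × Bool)) :
    ∃ a, facet a = {center, rim (triangle u), side u} :=
  ⟨.inr (.inl u), rfl⟩

theorem exists_facet_spokes {l m k : Fin n × Bool} (hlm : l ≠ m) (hlk : l ≠ k) (hmk : m ≠ k) :
    ∃ a, facet a = {spoke l, spoke m, spoke k} :=
  ⟨.inr (.inr (.inl ⟨{l, m, k}, Finset.card_eq_three.mpr ⟨l, m, k, hlm, hlk, hmk, rfl⟩⟩)),
    by simp [facet]⟩

theorem exists_facet_leaves_spoke {l m : Fin n × Bool} (h : l ≠ m) (h1 : l.1 = m.1) :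
    ∃ a, facet a = {leaf l, leaf m, spoke l} := by
  refine ⟨.inr (.inr (.inr (.inl l))), ?_⟩
  obtain rfl : m = (l.1, !l.2) := by
    obtain ⟨i, b⟩ := l
    obtain ⟨j, c⟩ := m
    cases b <;> cases c <;> simp_all
  rfl

theorem exists_facet_leaf_spokes {l m : Fin n × Bool} (h : l ≠ m) :
    ∃ a, facet a = {leaf l, spoke l, spoke m} :=
  ⟨.inr (.inr (.inr (.inr (.inl ⟨(l, m), h⟩)))), rfl⟩

theorem exists_facet_rim_leaves {l m : Fin n × Bool} (h : l ≠ m) (h1 : l.1 = m.1) :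
    ∃ a, facet a = {rim l.1, leaf l, leaf m} := by
  refine ⟨.inr (.inr (.inr (.inr (.inr (.inl l.1))))), ?_⟩
  obtain ⟨i, b⟩ := l
  obtain ⟨j, c⟩ := m
  obtain rfl : i = j := h1
  cases b <;> cases c <;> simp_all [facet, Finset.pair_comm]

theorem exists_facet_rim_leaf_spoke {l m : Fin n × Bool} (h1 : l.1 = m.1) :
    ∃ a, facet a = {rim l.1, leaf l, spoke m} :=
  ⟨.inr (.inr (.inr (.inr (.inr (.inr (.inl (l.1, l.2, m.2))))))), by
    obtain ⟨i, b⟩ := l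
    obtain ⟨j, c⟩ := m
    obtain rfl : i = j := h1
    rfl⟩

end FriendshipCell

end FriendshipFacets

/-! ### The listed facets are exactly the total indices -/

section FriendshipComplex

namespace FriendshipCell

variable {n : ℕ}

theorem eq_map_facet {σ : Finset (TotalVertex (friendshipGraph n))} {a b c : FriendshipCell n}
    (h : ∃ x, facet x = {a, b, c})
    (hσ : (σ : Set (TotalVertex (friendshipGraph n))) =
      {totalEquiv a, totalEquiv b, totalEquiv c}) :
    ∃ x, σ = (facet x).map totalEquiv.toEmbedding := by
  obtain ⟨x, hx⟩ := h
  refine ⟨x, Finset.coe_injective ?_⟩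
  rw [hσ, hx]
  simp

/-- A case analysis on the generators. The bound on n serves to exclude an isolated center, whose
index would not be a triple. -/
theorem exists_facet_of_isTotalIndex (hn : 1 ≤ n)
    {σ : Finset (TotalVertex (friendshipGraph n))} (h : IsTotalIndex (friendshipGraph n) σ) :
    ∃ x, σ = (facet x).map totalEquiv.toEmbedding := by
  have leaf_ne : ∀ {l m : Fin n × Bool}, l ≠ m →
      (Sum.inl l : (Fin n × Bool) ⊕ (Fin n × Bool)) ≠ Sum.inl m :=
    fun h h' => h (Sum.inl_injective h')
  have spoke_ne : ∀ {l m : Fin n × Bool}, l ≠ m →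
      (Sum.inr l : (Fin n × Bool) ⊕ (Fin n × Bool)) ≠ Sum.inr m :=
    fun h h' => h (Sum.inr_injective h')
  cases h with
  | vertices p q r hpr hpq hqr hσ =>
    rcases q with _ | m
    · rcases p with _ | l
      · exact absurd rfl hpq.ne
      rcases r with _ | k
      · exact absurd rfl hqr.ne
      exact eq_map_facet (exists_facet_cone (leaf_ne fun h => hpr (congrArg some h)))
        (hσ.trans (by ext; simp; tauto))
    · rcases p with _ | l
      · rcases r with _ | k
        · exact absurd rfl hpr
        exact eq_map_facet (exists_facet_cone (leaf_ne ((adj_some_some _ _).mp hqr).1)) hσ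
      · rcases r with _ | k
        · exact eq_map_facet (exists_facet_cone (leaf_ne ((adj_some_some _ _).mp hpq).1))
            (hσ.trans (by ext; simp; tauto))
        -- Impossible: a path avoiding the center stays in one triangle, which has only two outer
        -- vertices.
        · obtain ⟨h1, h2⟩ := (adj_some_some _ _).mp hpq
          obtain ⟨h3, h4⟩ := (adj_some_some _ _).mp hqr
          obtain ⟨i, a⟩ := l
          obtain ⟨j, b⟩ := m
          obtain ⟨k, c⟩ := k
          cases a <;> cases b <;> cases c <;> simp_all
  | edges e f g heg hef hfg hσ =>
    rcases edge_cases e with ⟨l, rfl⟩ | ⟨i, rfl⟩ <;>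
    rcases edge_cases f with ⟨m, rfl⟩ | ⟨j, rfl⟩ <;>
    rcases edge_cases g with ⟨k, rfl⟩ | ⟨k, rfl⟩ <;>
    simp only [ne_eq, spokeEdge_inj, rimEdge_inj, adj_spoke_spoke, adj_spoke_rim, adj_rim_spoke,
      not_adj_rim_rim] at heg hef hfg
    · exact eq_map_facet (exists_facet_spokes hef heg hfg) hσ
    · subst hfg
      exact eq_map_facet (exists_facet_rim_spoke (Ne.symm hef)) (hσ.trans (by ext; simp; tauto))
    · subst hef
      exact eq_map_facet (exists_facet_rim_spoke heg) (hσ.trans (by ext; simp; tauto))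
    · subst hef
      exact eq_map_facet (exists_facet_rim_spoke hfg) hσ
    -- Two rims meeting a common spoke are both the rim of its triangle, hence equal.
    · exact absurd (hef.symm.trans hfg) heg
  | vertexVertexEdge p q e hpq he hσ =>
    rcases p with _ | l <;> rcases q with _ | m
    · exact absurd rfl hpq.ne
    · rcases edge_cases e with ⟨k, rfl⟩ | ⟨k, rfl⟩
      · exact eq_map_facet (exists_facet_cone (u := .inl m) (v := .inr k) (by simp)) hσ
      · obtain ⟨b, rfl⟩ : ∃ b, m = (k, b) := by simpa using he
        exact eq_map_facet (exists_facet_center_rim (.inl (k, b)))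
          (hσ.trans (by ext; simp [triangle]; tauto))
    · rcases edge_cases e with ⟨k, rfl⟩ | ⟨k, rfl⟩
      · exact eq_map_facet (exists_facet_cone (u := .inl l) (v := .inr k) (by simp))
          (hσ.trans (by ext; simp; tauto))
      · obtain ⟨b, rfl⟩ : ∃ b, l = (k, b) := by simpa using he
        exact eq_map_facet (exists_facet_center_rim (.inl (k, b)))
          (hσ.trans (by ext; simp [triangle]; tauto))
    · obtain ⟨h1, h2⟩ := (adj_some_some _ _).mp hpq
      rcases edge_cases e with ⟨k, rfl⟩ | ⟨k, rfl⟩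
      · have : l = k ∨ m = k := by simpa using he
        rcases this with rfl | rfl
        · exact eq_map_facet (exists_facet_leaves_spoke h1 h2) hσ
        · exact eq_map_facet (exists_facet_leaves_spoke (Ne.symm h1) h2.symm)
            (hσ.trans (by ext; simp; tauto))
      · have : l.1 = k := by
          simp only [mem_rimEdge, Option.some.injEq] at he
          rcases he with ⟨b, rfl⟩ | ⟨b, rfl⟩
          · rfl
          · exact h2
        subst this
        exact eq_map_facet (exists_facet_rim_leaves h1 h2) (hσ.trans (by ext; simp; tauto))
  | edgeEdgeVertex e f v hef hv hσ =>
    rcases edge_cases e with ⟨l, rfl⟩ | ⟨i, rfl⟩ <;>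
    rcases edge_cases f with ⟨m, rfl⟩ | ⟨j, rfl⟩ <;>
    rcases v with _ | k <;>
    simp only [adj_spoke_spoke, adj_spoke_rim, adj_rim_spoke, not_adj_rim_rim] at hef
    · exact eq_map_facet (exists_facet_cone (spoke_ne hef)) (hσ.trans (by ext; simp; tauto))
    · have : k = l ∨ k = m := by simpa using hv
      rcases this with rfl | rfl
      · exact eq_map_facet (exists_facet_leaf_spokes hef) (hσ.trans (by ext; simp; tauto))
      · exact eq_map_facet (exists_facet_leaf_spokes (Ne.symm hef))
          (hσ.trans (by ext; simp; tauto))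
    · subst hef
      exact eq_map_facet (exists_facet_center_rim (.inr l))
        (hσ.trans (by ext; simp [triangle]; tauto))
    · subst hef
      have : k.1 = l.1 := by
        simp only [mem_spokeEdge, mem_rimEdge, Option.some.injEq, reduceCtorEq, false_or] at hv
        rcases hv with rfl | ⟨b, rfl⟩ <;> rfl
      exact eq_map_facet (exists_facet_rim_leaf_spoke this)
        (hσ.trans (by rw [this]; ext; simp; tauto))
    · subst hef
      exact eq_map_facet (exists_facet_center_rim (.inr m))
        (hσ.trans (by ext; simp [triangle]; tauto))
    · subst hef
      have : k.1 = m.1 := by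
        simp only [mem_spokeEdge, mem_rimEdge, Option.some.injEq, reduceCtorEq, false_or] at hv
        rcases hv with ⟨b, rfl⟩ | rfl <;> rfl
      exact eq_map_facet (exists_facet_rim_leaf_spoke this)
        (hσ.trans (by rw [this]; ext; simp; tauto))
  | isolated v hv hσ =>
    rcases v with _ | l
    · exact absurd (adj_none_some (⟨0, hn⟩, false)) (hv _)
    · exact absurd (adj_some_none l) (hv _)

theorem isTotalIndex_map_facet (x : FacetIndex n) :
    IsTotalIndex (friendshipGraph n) ((facet x).map totalEquiv.toEmbedding) := by
  rcases x with ⟨s, hs⟩ | u | ⟨s, hs⟩ | l | ⟨⟨l, m⟩, h⟩ | i | ⟨i, b, c⟩ | i | ⟨⟨l, m⟩, h⟩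
  · obtain ⟨u, v, huv, rfl⟩ := Finset.card_eq_two.mp hs
    rcases u with l | l <;> rcases v with m | m
    · exact .vertices _ (some l) none (some m) (fun h => huv (by simpa using h)) (by simp) (by simp)
        (by ext; simp [facet]; tauto)
    · exact .vertexVertexEdge _ none (some l) (spokeEdge m) (by simp) (by simp)
        (by ext; simp [facet])
    · exact .vertexVertexEdge _ none (some m) (spokeEdge l) (by simp) (by simp)
        (by ext; simp [facet]; tauto)
    · exact .edgeEdgeVertex _ (spokeEdge l) (spokeEdge m) none (by simpa using huv) (by simp)
        (by ext; simp [facet]; tauto)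
  · rcases u with l | l
    · exact .vertexVertexEdge _ none (some l) (rimEdge l.1) (by simp) (by simp [Prod.ext_iff])
        (by ext; simp [facet, triangle]; tauto)
    · exact .edgeEdgeVertex _ (rimEdge l.1) (spokeEdge l) none (by simp) (by simp)
        (by ext; simp [facet, triangle]; tauto)
  · obtain ⟨l, m, k, hlm, hlk, hmk, rfl⟩ := Finset.card_eq_three.mp hs
    exact .edges _ (spokeEdge l) (spokeEdge m) (spokeEdge k) (by simpa) (by simpa) (by simpa)
      (by ext; simp [facet])
  · refine .vertexVertexEdge _ (some l) (some (l.1, !l.2)) (spokeEdge l) ?_ (by simp)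
      (by ext; simp [facet])
    obtain ⟨i, b⟩ := l
    cases b <;> simp
  · exact .edgeEdgeVertex _ (spokeEdge l) (spokeEdge m) (some l) (by simpa using h) (by simp)
      (by ext; simp [facet]; tauto)
  · exact .vertexVertexEdge _ (some (i, false)) (some (i, true)) (rimEdge i) (by simp) (by simp)
      (by ext; simp [facet]; tauto)
  · exact .edgeEdgeVertex _ (rimEdge i) (spokeEdge (i, c)) (some (i, b)) (by simp) (by simp)
      (by ext; simp [facet]; tauto)
  · exact .edges _ (spokeEdge (i, false)) (rimEdge i) (spokeEdge (i, true)) (by simp) (by simp)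
      (by simp) (by ext; simp [facet]; tauto)
  · exact .edges _ (rimEdge l.1) (spokeEdge l) (spokeEdge m) (by simp) (by simp)
      (by simp only [adj_spoke_spoke]; exact fun e => h (congrArg Prod.fst e))
      (by ext; simp [facet])

theorem map_mem_faces_of_subset {t : Finset (FriendshipCell n)} (ht : t.Nonempty)
    {a b c : FriendshipCell n} (h : ∃ x, facet x = {a, b, c}) (hs : t ⊆ {a, b, c}) :
    t.map totalEquiv.toEmbedding ∈ (totalSimplicialComplex (friendshipGraph n)).faces := by
  obtain ⟨x, hx⟩ := h
  exact ⟨ht.map, _, isTotalIndex_map_facet x, Finset.map_subset_map.mpr (hx ▸ hs)⟩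

theorem exists_subset_facet (hn : 1 ≤ n) {s : Finset (TotalVertex (friendshipGraph n))}
    (hs : s ∈ (totalSimplicialComplex (friendshipGraph n)).faces) :
    ∃ x, s ⊆ (facet x).map totalEquiv.toEmbedding := by
  obtain ⟨-, σ, hσ, hsσ⟩ := hs
  obtain ⟨x, rfl⟩ := exists_facet_of_isTotalIndex hn hσ
  exact ⟨x, hsσ⟩

theorem center_pair_mem_faces (hn : 1 ≤ n) (w : FriendshipCell n) :
    ({center, w} : Finset (FriendshipCell n)).map totalEquiv.toEmbedding ∈
      (totalSimplicialComplex (friendshipGraph n)).faces := by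
  rcases w with _ | u | i
  · exact map_mem_faces_of_subset (by simp) (exists_facet_center_rim (.inl (⟨0, hn⟩, false)))
      (by intro; simp; tauto)
  · exact map_mem_faces_of_subset (by simp) (exists_facet_center_rim u) (by intro; simp; tauto)
  · exact map_mem_faces_of_subset (by simp) (exists_facet_center_rim (.inl (i, false)))
      (by intro; simp [triangle]; tauto)

theorem singleton_mem_faces (hn : 1 ≤ n) (w : FriendshipCell n) :
    ({w} : Finset (FriendshipCell n)).map totalEquiv.toEmbedding ∈
      (totalSimplicialComplex (friendshipGraph n)).faces :=
  ((totalSimplicialComplex (friendshipGraph n)).isRelLowerSet_faces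
    (center_pair_mem_faces hn w)).2 (Finset.map_subset_map.mpr (by simp)) (by simp)

theorem side_pair_mem_faces {u v : (Fin n × Bool) ⊕ (Fin n × Bool)} (h : u ≠ v) :
    ({side u, side v} : Finset (FriendshipCell n)).map totalEquiv.toEmbedding ∈
      (totalSimplicialComplex (friendshipGraph n)).faces :=
  map_mem_faces_of_subset (by simp) (exists_facet_cone h) (by simp)

/-- Even when the rim and the spoke have no common endpoint, the spoke (i, false) meets both, and
the three are adjacent edges. -/
theorem rim_spoke_mem_faces (i : Fin n) (l : Fin n × Bool) :
    ({rim i, spoke l} : Finset (FriendshipCell n)).map totalEquiv.toEmbedding ∈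
      (totalSimplicialComplex (friendshipGraph n)).faces := by
  by_cases h : (i, false) = l
  · subst h
    exact map_mem_faces_of_subset (by simp) (exists_facet_center_rim (.inr (i, false)))
      (by simp [triangle])
  · exact map_mem_faces_of_subset (by simp) (exists_facet_rim_spoke h)
      (by intro; simp; tauto)

theorem rim_leaf_mem_faces (l : Fin n × Bool) :
    ({rim l.1, leaf l} : Finset (FriendshipCell n)).map totalEquiv.toEmbedding ∈
      (totalSimplicialComplex (friendshipGraph n)).faces :=
  map_mem_faces_of_subset (by simp) (exists_facet_center_rim (.inl l)) (by simp [triangle])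

theorem not_rim_rim_subset_facet {i j : Fin n} (h : i ≠ j) (x : FacetIndex n) :
    ¬ (rim i ∈ facet x ∧ rim j ∈ facet x) := by
  rcases x with s | u | s | l | p | k | p | k | p <;> simp [facet] <;>
    exact fun h1 h2 => h (h1.trans h2.symm)

/-- The facets having both a rim and a leaf are built inside one triangle. Pairs of distinct rims,
and a rim with a leaf of another triangle, are the only pairs of cells that are not edges of the
complex. -/
theorem triangle_eq_of_subset_facet {i : Fin n} {l : Fin n × Bool} (x : FacetIndex n)
    (h1 : rim i ∈ facet x) (h2 : leaf l ∈ facet x) : i = l.1 := by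
  rcases x with s | u | s | k | p | k | p | k | p <;> simp [facet] at h1 h2
  · simp [h1, ← h2, triangle]
  · rcases h2 with rfl | rfl <;> exact h1
  · simp [h1, h2]

end FriendshipCell

end FriendshipComplex

/-! ### Counting vertices, edges and facets -/

section FriendshipHomology

namespace FriendshipCell

variable {n : ℕ}

theorem exists_map_eq (s : Finset (TotalVertex (friendshipGraph n))) :
    ∃ t : Finset (FriendshipCell n), t.map totalEquiv.toEmbedding = s :=
  ⟨s.map totalEquiv.symm.toEmbedding, by ext; simp⟩

/-- A code for the edges. -/
abbrev EdgeIndex (n : ℕ) : Type :=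
  ((Fin n × Bool) ⊕ (Fin n × Bool)) ⊕
  Fin n ⊕
  {s : Finset ((Fin n × Bool) ⊕ (Fin n × Bool)) // s.card = 2} ⊕
  (Fin n × (Fin n × Bool)) ⊕
  (Fin n × Bool)

/-- The edges of the total complex of the friendship graph. -/
def edge : EdgeIndex n → Finset (FriendshipCell n) :=
  Sum.elim (fun u => {center, side u}) <|
  Sum.elim (fun i => {center, rim i}) <|
  Sum.elim (fun s => s.1.map ⟨side, side_injective⟩) <|
  Sum.elim (fun p => {rim p.1, spoke p.2}) <|
  fun l => {rim l.1, leaf l}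

theorem edge_card (a : EdgeIndex n) : (edge a).card = 2 := by
  rcases a with u | i | s | p | l
  · simp [edge]
  · simp [edge]
  · simp [edge, s.2]
  · simp [edge]
  · simp [edge]

theorem edge_injective : Function.Injective (edge (n := n)) := by
  refine Function.Injective.sumElim ?_ (Function.Injective.sumElim ?_
    (Function.Injective.sumElim ?_ (Function.Injective.sumElim ?_ ?_ ?_) ?_) ?_) ?_
  · intro u v h
    simp [Finset.Subset.antisymm_iff, Finset.insert_subset_iff] at h
    exact h.1
  · intro u v h
    simp [Finset.Subset.antisymm_iff, Finset.insert_subset_iff] at h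
    exact h.1
  · intro s t h
    exact Subtype.ext (Finset.map_injective _ h)
  · rintro ⟨i, l⟩ ⟨j, m⟩ h
    simp [Finset.Subset.antisymm_iff, Finset.insert_subset_iff] at h
    grind
  · intro l m h
    simp [Finset.Subset.antisymm_iff, Finset.insert_subset_iff] at h
    exact h.1.2
  · rintro p q h
    simp [Finset.Subset.antisymm_iff, Finset.insert_subset_iff] at h
  · rintro p (q | q) h <;> simp [Finset.Subset.antisymm_iff, Finset.insert_subset_iff] at h
  · rintro p (q | q | q) h <;> simp [Finset.Subset.antisymm_iff, Finset.insert_subset_iff] at h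
  · rintro p (q | q | q | q) h <;>
      simp [Finset.Subset.antisymm_iff, Finset.insert_subset_iff] at h

theorem edge_mem_faces (hn : 1 ≤ n) (x : EdgeIndex n) :
    (edge x).map totalEquiv.toEmbedding ∈ (totalSimplicialComplex (friendshipGraph n)).faces := by
  rcases x with u | i | ⟨s, hs⟩ | ⟨i, l⟩ | l
  · exact center_pair_mem_faces hn _
  · exact center_pair_mem_faces hn _
  · obtain ⟨u, v, huv, rfl⟩ := Finset.card_eq_two.mp hs
    convert side_pair_mem_faces huv using 2
    simp [edge]
  · exact rim_spoke_mem_faces i l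
  · exact rim_leaf_mem_faces l

theorem exists_edge_eq {a b : FriendshipCell n} (hab : a ≠ b) {x : FacetIndex n}
    (ha : a ∈ facet x) (hb : b ∈ facet x) : ∃ y, edge y = {a, b} := by
  have sides : ∀ {u v : (Fin n × Bool) ⊕ (Fin n × Bool)}, u ≠ v →
      ∃ y, edge y = {side u, side v} := fun {u v} h =>
    ⟨.inr (.inr (.inl ⟨{u, v}, Finset.card_pair h⟩)), by simp [edge]⟩
  have rims : ∀ {i : Fin n} {u : (Fin n × Bool) ⊕ (Fin n × Bool)}, rim i ∈ facet x →
      side u ∈ facet x → ∃ y, edge y = {rim i, side u} := by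
    rintro i (l | l) hi hl
    · obtain rfl := triangle_eq_of_subset_facet x hi hl
      exact ⟨.inr (.inr (.inr (.inr l))), rfl⟩
    · exact ⟨.inr (.inr (.inr (.inl (i, l)))), rfl⟩
  rcases a with _ | u | i <;> rcases b with _ | v | j
  · exact absurd rfl hab
  · exact ⟨.inl v, rfl⟩
  · exact ⟨.inr (.inl j), rfl⟩
  · exact ⟨.inl u, Finset.pair_comm _ _⟩
  · exact sides fun h => hab (congrArg side h)
  · rw [Finset.pair_comm]
    exact rims hb ha
  · exact ⟨.inr (.inl i), Finset.pair_comm _ _⟩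
  · exact rims ha hb
  · exact absurd ⟨ha, hb⟩ (not_rim_rim_subset_facet (fun h => hab (congrArg rim h)) x)

theorem card_faces_zero (hn : 1 ≤ n) :
    Nat.card (FacesOfDim (totalSimplicialComplex (friendshipGraph n)) 0) = 5 * n + 1 := by
  have e : Unit ⊕ ((Fin n × Bool) ⊕ (Fin n × Bool)) ⊕ Fin n ≃
      FacesOfDim (totalSimplicialComplex (friendshipGraph n)) 0 := by
    let w : Unit ⊕ ((Fin n × Bool) ⊕ (Fin n × Bool)) ⊕ Fin n → FriendshipCell n :=
      Sum.elim (fun _ => center) (Sum.elim side rim)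
    refine Equiv.ofBijective (fun x => ⟨Finset.map totalEquiv.toEmbedding {w x},
      singleton_mem_faces hn _, by simp⟩) ⟨?_, ?_⟩
    · rintro x y h
      have hw : w x = w y := by simpa using h
      rcases x with x | x | x <;> rcases y with y | y | y <;> simp_all [w]
    · rintro ⟨s, hs, hc⟩
      obtain ⟨t, rfl⟩ := exists_map_eq s
      obtain ⟨a, rfl⟩ := Finset.card_eq_one.mp ((Finset.card_map _).symm.trans hc)
      rcases a with _ | u | i
      · exact ⟨.inl (), rfl⟩
      · exact ⟨.inr (.inl u), rfl⟩
      · exact ⟨.inr (.inr i), rfl⟩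
  rw [← Nat.card_congr e]
  simp
  ring

theorem choose_four_mul_two (hn : 1 ≤ n) : (4 * n).choose 2 + 2 * n = 8 * n ^ 2 := by
  have h := Nat.choose_succ_right_eq (4 * n) 1
  -- Writing n = 1 + m removes the truncated subtraction in 4n - 1.
  obtain ⟨m, rfl⟩ := Nat.exists_eq_add_of_le hn
  rw [Nat.choose_one_right, show 4 * (1 + m) - 1 = 4 * m + 3 by omega] at h
  linarith

theorem card_faces_one (hn : 1 ≤ n) :
    Nat.card (FacesOfDim (totalSimplicialComplex (friendshipGraph n)) 1) = 10 * n ^ 2 + 5 * n := by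
  have e : EdgeIndex n ≃ FacesOfDim (totalSimplicialComplex (friendshipGraph n)) 1 := by
    refine Equiv.ofBijective (fun x => ⟨(edge x).map totalEquiv.toEmbedding,
      edge_mem_faces hn _, by rw [Finset.card_map, edge_card]⟩) ⟨?_, ?_⟩
    · intro x y h
      exact edge_injective (Finset.map_injective _ (congrArg Subtype.val h))
    · rintro ⟨s, hs, hc⟩
      obtain ⟨t, rfl⟩ := exists_map_eq s
      obtain ⟨a, b, hab, rfl⟩ := Finset.card_eq_two.mp ((Finset.card_map _).symm.trans hc)
      obtain ⟨x, hx⟩ := exists_subset_facet hn hs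
      rw [Finset.map_subset_map] at hx
      obtain ⟨y, hy⟩ := exists_edge_eq hab (hx (by simp)) (hx (by simp))
      exact ⟨y, Subtype.ext (congrArg (Finset.map totalEquiv.toEmbedding) hy)⟩
  rw [← Nat.card_congr e]
  have h2 := choose_four_mul_two hn
  simp [Nat.card_eq_fintype_card, Fintype.card_finset_len]
  rw [show n * 2 + n * 2 = 4 * n by ring]
  nlinarith

/-- Every face lies in a listed facet, and facets have three elements, so a face of three elements
is a facet. The factor 3 clears the denominator of the binomial coefficient (2n choose 3). -/
theorem card_faces_two (hn : 1 ≤ n) :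
    3 * Nat.card (FacesOfDim (totalSimplicialComplex (friendshipGraph n)) 2) =
      4 * n ^ 3 + 42 * n ^ 2 + 14 * n := by
  have e : FacetIndex n ≃ FacesOfDim (totalSimplicialComplex (friendshipGraph n)) 2 := by
    refine Equiv.ofBijective (fun x => ⟨(facet x).map totalEquiv.toEmbedding,
      ⟨Finset.card_pos.mp (by simp [facet_card]), _, isTotalIndex_map_facet x, subset_rfl⟩,
      by rw [Finset.card_map, facet_card]⟩) ⟨?_, ?_⟩
    · intro x y h
      exact facet_injective (Finset.map_injective _ (congrArg Subtype.val h))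
    · rintro ⟨s, hs, hc⟩
      obtain ⟨x, hx⟩ := exists_subset_facet hn hs
      exact ⟨x, Subtype.ext (Finset.eq_of_subset_of_card_le hx
        (by rw [Finset.card_map, facet_card, hc])).symm⟩
  rw [← Nat.card_congr e]
  -- Count the complement: the diagonal has 2n elements here, and the pairs within one triangle
  -- number 4n in the next count.
  have hp : Nat.card {p : (Fin n × Bool) × (Fin n × Bool) // p.1 ≠ p.2} + 2 * n =
      4 * n ^ 2 := by
    have e1 : {p : (Fin n × Bool) × (Fin n × Bool) // p.1 = p.2} ≃ Fin n × Bool :=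
      { toFun := fun p => p.1.1
        invFun := fun l => ⟨(l, l), rfl⟩
        left_inv := fun ⟨⟨l, m⟩, h⟩ => Subtype.ext (Prod.ext rfl h)
        right_inv := fun _ => rfl }
    have := Nat.card_congr (Equiv.sumCompl fun p : (Fin n × Bool) × (Fin n × Bool) => p.1 = p.2)
    rw [Nat.card_sum, Nat.card_congr e1] at this
    simp only [Nat.card_eq_fintype_card, Fintype.card_prod, Fintype.card_fin, Fintype.card_bool,
      ne_eq] at this ⊢
    linarith
  have hq : Nat.card {p : (Fin n × Bool) × (Fin n × Bool) // p.1.1 ≠ p.2.1} + 4 * n =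
      4 * n ^ 2 := by
    have e1 : {p : (Fin n × Bool) × (Fin n × Bool) // p.1.1 = p.2.1} ≃ Fin n × Bool × Bool :=
      { toFun := fun p => (p.1.1.1, p.1.1.2, p.1.2.2)
        invFun := fun l => ⟨((l.1, l.2.1), (l.1, l.2.2)), rfl⟩
        left_inv := fun ⟨⟨l, m⟩, h⟩ => Subtype.ext (Prod.ext rfl (Prod.ext h rfl))
        right_inv := fun _ => rfl }
    have := Nat.card_congr
      (Equiv.sumCompl fun p : (Fin n × Bool) × (Fin n × Bool) => p.1.1 = p.2.1)
    rw [Nat.card_sum, Nat.card_congr e1] at this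
    simp only [Nat.card_eq_fintype_card, Fintype.card_prod, Fintype.card_fin, Fintype.card_bool,
      ne_eq] at this ⊢
    linarith
  have h2 := choose_four_mul_two hn
  have h3 : 3 * (2 * n).choose 3 + 6 * n ^ 2 = 4 * n ^ 3 + 2 * n := by
    have h := Nat.choose_succ_right_eq (2 * n) 1
    have h' := Nat.choose_succ_right_eq (2 * n) 2
    obtain ⟨m, rfl⟩ := Nat.exists_eq_add_of_le hn
    rw [Nat.choose_one_right, show 2 * (1 + m) - 1 = 2 * m + 1 by omega] at h
    rw [show 2 * (1 + m) - 2 = 2 * m by omega] at h'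
    nlinarith
  simp only [ne_eq, Nat.card_eq_fintype_card] at hp hq
  simp only [Nat.card_eq_fintype_card, Fintype.card_sum, Fintype.card_finset_len, ne_eq,
    Fintype.card_prod, Fintype.card_fin, Fintype.card_bool]
  rw [show n * 2 + n * 2 = 4 * n by ring, show n * 2 = 2 * n by ring]
  nlinarith

theorem isEmpty_faces (hn : 1 ≤ n) {r : ℕ} (hr : 3 ≤ r) :
    IsEmpty (FacesOfDim (totalSimplicialComplex (friendshipGraph n)) r) := by
  refine ⟨fun σ => ?_⟩
  obtain ⟨x, hx⟩ := exists_subset_facet hn σ.2.1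
  have := Finset.card_le_card hx
  rw [Finset.card_map, facet_card, σ.2.2] at this
  omega

/-! ### Closed paths through the center bound -/

/-- Two distinct sides span a facet with the center, as do a rim and a leaf of its triangle. The
pair of a rim and a spoke is the only one that may need more than one facet. -/
theorem cone_cycle_mem_boundaries (K : Type*) [CommRing K] (hn : 1 ≤ n)
    [LinearOrder (TotalVertex (friendshipGraph n))] (a b : FriendshipCell n)
    (h : Finset.map totalEquiv.toEmbedding {a, b} ∈
      (totalSimplicialComplex (friendshipGraph n)).faces) :
    orientedEdge K (totalSimplicialComplex (friendshipGraph n)) (totalEquiv center)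
        (totalEquiv a) +
      orientedEdge K (totalSimplicialComplex (friendshipGraph n)) (totalEquiv a) (totalEquiv b) +
      orientedEdge K (totalSimplicialComplex (friendshipGraph n)) (totalEquiv b)
        (totalEquiv center) ∈
      simplicialBoundaries K (totalSimplicialComplex (friendshipGraph n)) 1 := by
  have tri : ∀ {a b c : FriendshipCell n}, (∃ x, facet x = {a, b, c}) →
      orientedEdge K (totalSimplicialComplex (friendshipGraph n)) (totalEquiv a) (totalEquiv b) +
      orientedEdge K (totalSimplicialComplex (friendshipGraph n)) (totalEquiv b) (totalEquiv c) +
      orientedEdge K (totalSimplicialComplex (friendshipGraph n)) (totalEquiv c) (totalEquiv a) ∈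
      simplicialBoundaries K (totalSimplicialComplex (friendshipGraph n)) 1 := by
    intro a b c h
    refine orientedEdge_cycle_mem_boundaries ?_
    convert map_mem_faces_of_subset (by simp) h subset_rfl using 1
    ext
    simp
  have swap : ∀ {a b c : FriendshipCell n},
      orientedEdge K (totalSimplicialComplex (friendshipGraph n)) (totalEquiv a) (totalEquiv b) +
      orientedEdge K (totalSimplicialComplex (friendshipGraph n)) (totalEquiv b) (totalEquiv c) +
      orientedEdge K (totalSimplicialComplex (friendshipGraph n)) (totalEquiv c) (totalEquiv a) ∈
      simplicialBoundaries K (totalSimplicialComplex (friendshipGraph n)) 1 →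
      orientedEdge K (totalSimplicialComplex (friendshipGraph n)) (totalEquiv a) (totalEquiv c) +
      orientedEdge K (totalSimplicialComplex (friendshipGraph n)) (totalEquiv c) (totalEquiv b) +
      orientedEdge K (totalSimplicialComplex (friendshipGraph n)) (totalEquiv b) (totalEquiv a) ∈
      simplicialBoundaries K (totalSimplicialComplex (friendshipGraph n)) 1 := by
    intro a b c h
    convert neg_mem h using 1
    rw [orientedEdge_symm (totalEquiv a) (totalEquiv b),
      orientedEdge_symm (totalEquiv b) (totalEquiv c),
      orientedEdge_symm (totalEquiv c) (totalEquiv a)]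
    abel
  have hx : ∃ x, a ∈ facet x ∧ b ∈ facet x := by
    obtain ⟨x, hx⟩ := exists_subset_facet hn h
    rw [Finset.map_subset_map] at hx
    exact ⟨x, hx (by simp), hx (by simp)⟩
  clear h
  have rim_side : ∀ {i : Fin n} {u : (Fin n × Bool) ⊕ (Fin n × Bool)},
      (∃ x, rim i ∈ facet x ∧ side u ∈ facet x) →
      orientedEdge K (totalSimplicialComplex (friendshipGraph n)) (totalEquiv center)
        (totalEquiv (rim i)) +
      orientedEdge K (totalSimplicialComplex (friendshipGraph n)) (totalEquiv (rim i))
        (totalEquiv (side u)) +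
      orientedEdge K (totalSimplicialComplex (friendshipGraph n)) (totalEquiv (side u))
        (totalEquiv center) ∈
      simplicialBoundaries K (totalSimplicialComplex (friendshipGraph n)) 1 := by
    rintro i (l | l) ⟨x, h1, h2⟩
    · obtain rfl := triangle_eq_of_subset_facet x h1 h2
      exact tri (exists_facet_center_rim (.inl l))
    · by_cases hl : (i, false) = l
      · subst hl
        exact tri (exists_facet_center_rim (.inr (i, false)))
      -- With s the spoke (i, false), the facets {center, rim i, s}, {center, s, spoke l} and {rim
      -- i, s, spoke l} form a disc around s. Its three inner edges cancel, leaving center → rim i →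
      -- spoke l → center.
      · have t1 := tri (exists_facet_center_rim (.inr (i, false)))
        have t2 := tri (exists_facet_cone (u := .inr (i, false)) (v := .inr l) (by simpa using hl))
        have t3 := swap (tri (exists_facet_rim_spoke hl))
        convert add_mem (add_mem t1 t2) t3 using 1
        rw [orientedEdge_symm (totalEquiv (side (Sum.inr (i, false)))) (totalEquiv center),
          orientedEdge_symm (totalEquiv (side (Sum.inr l))) (totalEquiv (spoke (i, false))),
          orientedEdge_symm (totalEquiv (spoke (i, false))) (totalEquiv (rim _))]
        simp only [triangle, Sum.elim_inr]
        abel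
  rcases a with _ | u | i
  · simp [orientedEdge_self, orientedEdge_symm (totalEquiv b)]
  all_goals rcases b with _ | v | j
  · simp [orientedEdge_self, orientedEdge_symm (totalEquiv (side u))]
  · by_cases huv : u = v
    · subst huv
      simp [orientedEdge_self, orientedEdge_symm (totalEquiv (side u))]
    · exact tri (exists_facet_cone huv)
  · exact swap (rim_side (hx.imp fun _ h => h.symm))
  · simp [orientedEdge_self, orientedEdge_symm (Sum.inr (rimEdge i))]
  · exact rim_side hx
  · obtain ⟨x, hx⟩ := hx
    by_cases hij : i = j
    · subst hij
      simp [orientedEdge_self, orientedEdge_symm (Sum.inr (rimEdge i))]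
    · exact absurd hx (not_rim_rim_subset_facet hij x)

end FriendshipCell

end FriendshipHomology

/-! ### Assembling the homology -/

theorem lemma4p2 (K : Type*) [Field K] (n : ℕ) (hn : 1 ≤ n)
    [LinearOrder (TotalVertex (friendshipGraph n))] :
    Nonempty (SimplicialHomology K (totalSimplicialComplex (friendshipGraph n)) 0 ≃ₗ[K] K) ∧
    Subsingleton (SimplicialHomology K (totalSimplicialComplex (friendshipGraph n)) 1) ∧
    (∃ β₂ : ℕ, (β₂ : ℚ) = (4 * (n : ℚ) ^ 3 + 12 * (n : ℚ) ^ 2 + 14 * (n : ℚ)) / 3 ∧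
      Nonempty (SimplicialHomology K (totalSimplicialComplex (friendshipGraph n)) 2 ≃ₗ[K]
        (Fin β₂ → K))) ∧
    ∀ r : ℕ, 3 ≤ r →
      Subsingleton (SimplicialHomology K (totalSimplicialComplex (friendshipGraph n)) r) := by
  have h0 : Nonempty
      (SimplicialHomology K (totalSimplicialComplex (friendshipGraph n)) 0 ≃ₗ[K] K) := by
    refine nonempty_simplicialHomology_zero_equiv
      (FriendshipCell.totalEquiv FriendshipCell.center) ?_ fun v _ => ?_
    · simpa using FriendshipCell.singleton_mem_faces hn FriendshipCell.center
    · obtain ⟨w, rfl⟩ := FriendshipCell.totalEquiv.surjective v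
      convert FriendshipCell.center_pair_mem_faces hn w using 1
      ext
      simp
  have h1 : simplicialCycles K (totalSimplicialComplex (friendshipGraph n)) 1 ≤
      simplicialBoundaries K (totalSimplicialComplex (friendshipGraph n)) 1 := by
    refine simplicialCycles_one_le_boundaries
      (FriendshipCell.totalEquiv FriendshipCell.center) fun u v h => ?_
    obtain ⟨a, rfl⟩ := FriendshipCell.totalEquiv.surjective u
    obtain ⟨b, rfl⟩ := FriendshipCell.totalEquiv.surjective v
    refine FriendshipCell.cone_cycle_mem_boundaries K hn a b ?_
    convert h using 1
    ext
    simp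
  have c0 := FriendshipCell.card_faces_zero hn
  have c1 := FriendshipCell.card_faces_one hn
  have c2 := FriendshipCell.card_faces_two hn
  -- The number 10n² is f_1 - f_0 + 1, so β is the second Betti number predicted by the Euler
  -- characteristic. Defining it by an equation in ℕ makes its integrality automatic.
  obtain ⟨β, hβ⟩ : ∃ β, Nat.card (FacesOfDim (totalSimplicialComplex (friendshipGraph n)) 2) =
      β + (10 * n ^ 2) := by
    refine Nat.exists_eq_add_of_le' ?_
    have : n ^ 3 + n ≥ 2 * n ^ 2 := by
      nlinarith [sq_nonneg ((n : ℤ) - 1), Nat.zero_le n]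
    nlinarith
  refine ⟨h0, subsingleton_simplicialHomology_of_le h1, ⟨β, ?_, ?_⟩, fun r hr =>
    subsingleton_simplicialHomology_of_isEmpty (FriendshipCell.isEmpty_faces hn hr)⟩
  · rw [hβ] at c2
    have : (3 * (β + 10 * n ^ 2) : ℚ) = 4 * n ^ 3 + 42 * n ^ 2 + 14 * n := mod_cast c2
    linarith
  · exact nonempty_simplicialHomology_two_equiv h0 h1 (FriendshipCell.isEmpty_faces hn le_rfl)
      (by rw [c0, c1, hβ]; ring)
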